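/- Let $X$ and $Y$ be real normed spaces. For $0 \neq x \in X$, a supporting functional at $x$ is a continuous linear functional $x^* \in X^*$ with $\|x^*\| = 1$ and $x^*(x) = \|x\|$; the space $X$ is called smooth if there is exactly one supporting functional at every nonzero $x \in X$. A map $f : X \to Y$ is called a phase-isometry if $$\{\|f(x)+f(y)\|,\ \|f(x)-f(y)\|\} = \{\|x+y\|,\ \|x-y\|\} \qquad \text{for all } x, y \in X.$$ Theorem. Let $X$ and $Y$ be real normed spaces with $X$ smooth (neither space is assumed complete), and let $f : X \to Y$ be a surjective phase-isometry. Then $f$ is phase-equivalent to a linear isometry: there is a function $\varepsilon : X \to \{-1, 1\}$ such that the map $x \mapsto \varepsilon(x) f(x)$ is a linear isometry from $X$ into $Y$. -/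

import Mathlib

/-- `φ` is a supporting functional at `x`: a continuous linear functional of norm one
with `φ x = ‖x‖`. -/
def IsSupportingFunctional {X : Type*} [NormedAddCommGroup X] [NormedSpace ℝ X]
    (φ : StrongDual ℝ X) (x : X) : Prop :=
  ‖φ‖ = 1 ∧ φ x = ‖x‖

/-- `x` is a smooth point: there is exactly one supporting functional at `x`. -/
def IsSmoothPoint {X : Type*} [NormedAddCommGroup X] [NormedSpace ℝ X] (x : X) : Prop :=
  ∃! φ : StrongDual ℝ X, IsSupportingFunctional φ x

/-- A real normed space is smooth if each of its nonzero elements is a smooth point. -/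
def IsSmoothNormedSpace (X : Type*) [NormedAddCommGroup X] [NormedSpace ℝ X] : Prop :=
  ∀ x : X, x ≠ 0 → IsSmoothPoint x

/-- A phase-isometry, the two sides of the equation being sets of real numbers. -/
def IsPhaseIsometry {X Y : Type*} [NormedAddCommGroup X] [NormedAddCommGroup Y]
    (f : X → Y) : Prop :=
  ∀ x y : X, ({‖f x + f y‖, ‖f x - f y‖} : Set ℝ) = {‖x + y‖, ‖x - y‖}

/-- `f` is phase-equivalent to a linear isometry: for some `ε` with values in `{-1, 1}`,
the map `x ↦ ε x • f x` is a linear isometry (into `Y`). -/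
def IsPhaseEquivalentToLinearIsometry {X Y : Type*} [NormedAddCommGroup X] [NormedSpace ℝ X]
    [NormedAddCommGroup Y] [NormedSpace ℝ Y] (f : X → Y) : Prop :=
  ∃ ε : X → ℝ, (∀ x, ε x = -1 ∨ ε x = 1) ∧
    ∃ L : X →ₗᵢ[ℝ] Y, ∀ x, ε x • f x = L x

open Filter Topology

/-! Smoothness makes the supporting functional `φ` at `x` the limit of `‖n x + y‖ - n ‖x‖`.
Comparing with functionals norming `f (n x)` yields `g` on `Y` with `|g ∘ f| = |φ|`
(`exists_abs_apply_eq`). Such `φ` can avoid annihilating any finite set of nonzero vectors, so `f z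
= f x + f y` forces `z = ±x ± y`. Fix `a ≠ 0` and, by surjectivity, `z` with `f z = f a + f x`:
whether `z` is `±(a + x)` or `±(a - x)` fixes the sign `ε x`. Then `g (ε x • f x) = φ x` for every
pair with `g (f a) = φ a ≠ 0`; these `g` separate points of `Y`, so `ε • f` is linear. -/

/-- Along an ultrafilter, every sequence in the dual unit ball converges pointwise to an element
of the dual unit ball. -/
theorem exists_tendsto_apply_of_norm_le_one {E : Type*} [NormedAddCommGroup E] [NormedSpace ℝ E]
    (U : Ultrafilter ℕ) (h : ℕ → StrongDual ℝ E) (hh : ∀ n, ‖h n‖ ≤ 1) :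
    ∃ g : StrongDual ℝ E, ‖g‖ ≤ 1 ∧ ∀ y, Tendsto (fun n => h n y) U (𝓝 (g y)) := by
  have hc := WeakDual.isCompact_closedBall (𝕜 := ℝ) (0 : StrongDual ℝ E) 1
  obtain ⟨g, hg, hlim⟩ := hc.ultrafilter_le_nhds (U.map fun n => StrongDual.toWeakDual (h n)) (by
    rw [le_principal_iff]
    exact Filter.Eventually.of_forall (f := (U : Filter ℕ)) fun n => by simpa using hh n)
  refine ⟨WeakDual.toStrongDual g, by simpa using hg, fun y => ?_⟩
  exact tendsto_iff_forall_eval_tendsto_topDualPairing.1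
    (show Tendsto (fun n => StrongDual.toWeakDual (h n)) (U : Filter ℕ) (𝓝 g) from hlim) y

theorem norm_eq_one_of_apply_eq_norm {E : Type*} [NormedAddCommGroup E] [NormedSpace ℝ E]
    {φ : StrongDual ℝ E} {x : E} (hx : x ≠ 0) (hφ : ‖φ‖ ≤ 1) (h : φ x = ‖x‖) : ‖φ‖ = 1 := by
  refine le_antisymm hφ ?_
  have h1 := φ.le_opNorm x
  rw [h, Real.norm_eq_abs, abs_norm] at h1
  have h2 : 0 < ‖x‖ := norm_pos_iff.2 hx
  nlinarith

theorem apply_le_norm_of_norm_le_one {E : Type*} [NormedAddCommGroup E] [NormedSpace ℝ E]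
    {φ : StrongDual ℝ E} (hφ : ‖φ‖ ≤ 1) (x : E) : φ x ≤ ‖x‖ :=
  (le_abs_self _).trans (by simpa using φ.le_of_opNorm_le hφ x)

/-- At a smooth point `x`, the differences `‖n x + y‖ - n ‖x‖` tend to the value at `y` of the
supporting functional. -/
theorem IsSmoothPoint.tendsto_norm_nsmul_add_sub {X : Type*} [NormedAddCommGroup X]
    [NormedSpace ℝ X] {x : X} (hx : x ≠ 0) (hs : IsSmoothPoint x) {φ : StrongDual ℝ X}
    (hφ : IsSupportingFunctional φ x) (U : Ultrafilter ℕ) (hU : (U : Filter ℕ) ≤ atTop) (y : X) :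
    Tendsto (fun n : ℕ => ‖(n : ℝ) • x + y‖ - n * ‖x‖) U (𝓝 (φ y)) := by
  choose ψ hψ hψv using fun n : ℕ => exists_dual_vector'' ℝ ((n : ℝ) • x + y)
  replace hψv : ∀ n : ℕ, ψ n ((n : ℝ) • x + y) = ‖(n : ℝ) • x + y‖ := hψv
  obtain ⟨g, hg, hlim⟩ := exists_tendsto_apply_of_norm_le_one U ψ hψ
  -- Since `ψ n` norms `n x + y`, it satisfies `ψ n x ≥ ‖x‖ - 2‖y‖ / n`.
  have hgx : g x = ‖x‖ := by
    have h0 : Tendsto (fun n : ℕ => ‖x‖ - 2 * ‖y‖ / (n : ℝ)) U (𝓝 ‖x‖) := by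
      simpa using tendsto_const_nhds.sub
        ((tendsto_const_div_atTop_nhds_zero_nat (2 * ‖y‖)).mono_left hU)
    refine tendsto_nhds_unique (hlim x) (tendsto_of_tendsto_of_tendsto_of_le_of_le' h0
      tendsto_const_nhds ?_ (Eventually.of_forall fun n => apply_le_norm_of_norm_le_one (hψ n) x))
    filter_upwards [hU (eventually_gt_atTop 0)] with n hn
    have hn' : (0 : ℝ) < n := by exact_mod_cast hn
    have h1 := hψv n
    rw [map_add, map_smul, smul_eq_mul] at h1
    have h2 := apply_le_norm_of_norm_le_one (hψ n) y
    have h3 := norm_sub_norm_le ((n : ℝ) • x) (-y)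
    rw [norm_neg, sub_neg_eq_add, norm_smul, Real.norm_natCast] at h3
    rw [sub_le_iff_le_add, ← sub_le_iff_le_add', le_div_iff₀ hn']
    linarith
  obtain rfl : g = φ := hs.unique ⟨norm_eq_one_of_apply_eq_norm hx hg hgx, hgx⟩ hφ
  -- Squeeze: `g` bounds the difference from below, and `ψ n y` from above.
  refine tendsto_of_tendsto_of_tendsto_of_le_of_le tendsto_const_nhds (hlim y)
    (fun n => ?_) fun n => ?_
  · have h1 := apply_le_norm_of_norm_le_one hg ((n : ℝ) • x + y)
    rw [map_add, map_smul, smul_eq_mul, hgx] at h1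
    change g y ≤ _
    linarith
  · have h1 := hψv n
    rw [map_add, map_smul, smul_eq_mul] at h1
    have h2 := mul_le_mul_of_nonneg_left (apply_le_norm_of_norm_le_one (hψ n) x) n.cast_nonneg
    change _ ≤ ψ n y
    linarith

namespace IsPhaseIsometry

section Norm

variable {X Y : Type*} [NormedAddCommGroup X] [NormedSpace ℝ X] [NormedAddCommGroup Y]
  [NormedSpace ℝ Y] {f : X → Y}

theorem norm_map (hf : IsPhaseIsometry f) (x : X) : ‖f x‖ = ‖x‖ := by
  have h := hf x x
  simp only [sub_self, norm_zero, ← two_smul ℝ, norm_smul, Real.norm_ofNat] at h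
  rcases Set.pair_eq_pair_iff.1 h with h | h <;> linarith [h.1, h.2]

theorem map_zero (hf : IsPhaseIsometry f) : f 0 = 0 := by
  simpa using hf.norm_map 0

/-- The supporting functional of a smooth point is, up to pointwise signs, the pull-back under `f`
of a functional. -/
theorem exists_abs_apply_eq (hf : IsPhaseIsometry f) {x : X} (hx : x ≠ 0) (hs : IsSmoothPoint x)
    {φ : StrongDual ℝ X} (hφ : IsSupportingFunctional φ x) :
    ∃ g : StrongDual ℝ Y, ∀ y, |g (f y)| = |φ y| := by
  choose ψ hψ hψv using fun n : ℕ => exists_dual_vector'' ℝ (f ((n : ℝ) • x))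
  replace hψv : ∀ n : ℕ, ψ n (f ((n : ℝ) • x)) = n * ‖x‖ := fun n => by
    refine (hψv n).trans ?_
    simp [hf.norm_map, norm_smul]
  let U : Ultrafilter ℕ := Ultrafilter.of atTop
  have hU : (U : Filter ℕ) ≤ atTop := Ultrafilter.of_le _
  obtain ⟨g, hg, hlim⟩ := exists_tendsto_apply_of_norm_le_one U ψ hψ
  refine ⟨g, fun y => ?_⟩
  have ha := hs.tendsto_norm_nsmul_add_sub hx hφ U hU y
  have hb := hs.tendsto_norm_nsmul_add_sub hx hφ U hU (-y)
  rw [map_neg] at hb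
  have hl := hlim (f y)
  -- The pairing of the two norms may vary with `n`; the ultrafilter selects one alternative, and
  -- the limits of its two inequalities then give an equality.
  have key : ∀ n : ℕ,
      (ψ n (f y) ≤ ‖(n : ℝ) • x + y‖ - n * ‖x‖ ∧ -ψ n (f y) ≤ ‖(n : ℝ) • x + -y‖ - n * ‖x‖) ∨
      (ψ n (f y) ≤ ‖(n : ℝ) • x + -y‖ - n * ‖x‖ ∧ -ψ n (f y) ≤ ‖(n : ℝ) • x + y‖ - n * ‖x‖) := by
    intro n
    have h1 := apply_le_norm_of_norm_le_one (hψ n) (f ((n : ℝ) • x) + f y)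
    have h2 := apply_le_norm_of_norm_le_one (hψ n) (f ((n : ℝ) • x) - f y)
    rw [map_add, hψv] at h1
    rw [map_sub, hψv] at h2
    rw [← sub_eq_add_neg]
    rcases Set.pair_eq_pair_iff.1 (hf ((n : ℝ) • x) y) with h | h
    · left; constructor <;> linarith [h.1, h.2]
    · right; constructor <;> linarith [h.1, h.2]
  rw [abs_eq_abs]
  rcases Ultrafilter.eventually_or.1 (Eventually.of_forall key : ∀ᶠ n in (U : Filter ℕ), _)
    with h | h
  · left
    have h1 := le_of_tendsto_of_tendsto hl ha (h.mono fun n hn => hn.1)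
    have h2 := le_of_tendsto_of_tendsto hl.neg hb (h.mono fun n hn => hn.2)
    linarith
  · right
    have h1 := le_of_tendsto_of_tendsto hl hb (h.mono fun n hn => hn.1)
    have h2 := le_of_tendsto_of_tendsto hl.neg ha (h.mono fun n hn => hn.2)
    linarith

end Norm

end IsPhaseIsometry

/-- Finitely many nonzero vectors are simultaneously not annihilated by some norm-attaining
functional. -/
theorem exists_isSupportingFunctional_forall_apply_ne_zero {X ι : Type*} [NormedAddCommGroup X]
    [NormedSpace ℝ X] [Finite ι] [Nonempty ι] (v : ι → X) (hv : ∀ i, v i ≠ 0) :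
    ∃ (w : X) (φ : StrongDual ℝ X), w ≠ 0 ∧ IsSupportingFunctional φ w ∧ ∀ i, φ (v i) ≠ 0 := by
  let F : Submodule ℝ X := Submodule.span ℝ (Set.range v)
  have : FiniteDimensional ℝ F := FiniteDimensional.span_of_finite ℝ (Set.finite_range v)
  let u : ι → F := fun i => ⟨v i, Submodule.subset_span ⟨i, rfl⟩⟩
  have hu : ∀ i, u i ≠ 0 := fun i h => hv i (congrArg Subtype.val h)
  obtain ⟨ψ₀, hψ₀⟩ := Module.exists_dual_forall_apply_ne_zero (K := ℝ) u hu
  let ψ : StrongDual ℝ F := LinearMap.toContinuousLinearMap ψ₀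
  have hψ : ∀ i, ψ (u i) ≠ 0 := hψ₀
  obtain ⟨i₀⟩ := ‹Nonempty ι›
  have : Nontrivial F := ⟨⟨u i₀, 0, hu i₀⟩⟩
  have : ProperSpace F := FiniteDimensional.proper ℝ F
  -- By compactness `ψ` attains its norm at some `w`; a norm-preserving extension still attains it
  -- there.
  obtain ⟨w, hw, hmax⟩ := (isCompact_sphere (0 : F) 1).exists_isMaxOn
    (NormedSpace.sphere_nonempty.2 zero_le_one) ψ.continuous.continuousOn
  have hw1 : ‖w‖ = 1 := by simpa using hw
  have hle : ∀ z : F, ‖z‖ = 1 → ψ z ≤ ψ w := fun z hz => hmax (by simpa using hz)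
  have hψw : 0 ≤ ψ w := by
    have := hle (-w) (by rwa [norm_neg])
    rw [map_neg] at this
    linarith
  have hnorm : ‖ψ‖ = ψ w := by
    refine le_antisymm (ψ.opNorm_le_of_unit_norm hψw fun z hz => ?_) ?_
    · rw [Real.norm_eq_abs, abs_le']
      exact ⟨hle z hz, by simpa using hle (-z) (by rwa [norm_neg])⟩
    · simpa [hw1] using (le_abs_self _).trans (ψ.le_opNorm w)
  have hpos : ‖ψ‖ ≠ 0 := fun h => hψ i₀ (by rw [norm_eq_zero (a := ψ) |>.1 h]; rfl)
  obtain ⟨φ, hφ, hφn⟩ := exists_extension_norm_eq F ψ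
  refine ⟨w, ‖ψ‖⁻¹ • φ, fun h => ?_, ⟨?_, ?_⟩, fun i => ?_⟩
  · rw [Submodule.coe_eq_zero] at h
    simp [h] at hw1
  · rw [norm_smul, hφn, norm_inv, hnorm, Real.norm_of_nonneg hψw, ← hnorm, inv_mul_cancel₀ hpos]
  · rw [_root_.smul_apply, hφ, ← hnorm, smul_eq_mul, inv_mul_cancel₀ hpos]
    exact hw1.symm
  · rw [_root_.smul_apply]
    exact smul_ne_zero (inv_ne_zero hpos) (by simpa [u] using (hφ (u i)).trans_ne (hψ i))

namespace IsPhaseIsometry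

variable {X Y : Type*} [NormedAddCommGroup X] [NormedSpace ℝ X] [NormedAddCommGroup Y]
  [NormedSpace ℝ Y] {f : X → Y}

theorem exists_abs_apply_eq_forall_apply_ne_zero (hf : IsPhaseIsometry f)
    (hX : IsSmoothNormedSpace X) {ι : Type*} [Finite ι] [Nonempty ι] (v : ι → X)
    (hv : ∀ i, v i ≠ 0) :
    ∃ (φ : StrongDual ℝ X) (g : StrongDual ℝ Y),
      (∀ y, |g (f y)| = |φ y|) ∧ ∀ i, φ (v i) ≠ 0 := by
  obtain ⟨w, φ, hw, hφ, hne⟩ := exists_isSupportingFunctional_forall_apply_ne_zero v hv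
  obtain ⟨g, hg⟩ := hf.exists_abs_apply_eq hw (hX w hw) hφ
  exact ⟨φ, g, hg, hne⟩

/-- The sum of two values of `f` is the value at one of the four signed sums. -/
theorem eq_signed_add_of_map_eq (hf : IsPhaseIsometry f) (hX : IsSmoothNormedSpace X) {x y z : X}
    (h : f z = f x + f y) :
    z = x + y ∨ z = -(x + y) ∨ z = x - y ∨ z = -(x - y) := by
  -- One `φ` nonzero on all four differences contradicts `g (f z) = g (f x) + g (f y)`, which reads
  -- `±φ z = ±φ x ± φ y`.
  by_contra! hne
  obtain ⟨h1, h2, h3, h4⟩ := hne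
  obtain ⟨φ, g, hg, hφ⟩ := hf.exists_abs_apply_eq_forall_apply_ne_zero hX
    ![z - (x + y), z + (x + y), z - (x - y), z + (x - y)] (by
      intro i
      fin_cases i
      · exact sub_ne_zero.2 h1
      · exact fun h => h2 (eq_neg_of_add_eq_zero_left h)
      · exact sub_ne_zero.2 h3
      · exact fun h => h4 (eq_neg_of_add_eq_zero_left h))
  have e1 := hφ 0
  have e2 := hφ 1
  have e3 := hφ 2
  have e4 := hφ 3
  simp only [Matrix.cons_val, map_sub, map_add] at e1 e2 e3 e4
  have hz := congrArg g h
  rw [map_add] at hz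
  rcases abs_eq_abs.1 (hg x) with hx | hx <;> rcases abs_eq_abs.1 (hg y) with hy | hy <;>
    rcases abs_eq_abs.1 (hg z) with hz' | hz' <;> rw [hx, hy, hz'] at hz <;>
    first
    | exact e1 (by linarith)
    | exact e2 (by linarith)
    | exact e3 (by linarith)
    | exact e4 (by linarith)

/-- Signs can be chosen such that every functional which agrees with `φ` up to signs along `f`,
and agrees with it at a base point not annihilated by `φ`, agrees with it after correction by the
signs. -/
theorem exists_sign_forall_apply_eq (hf : IsPhaseIsometry f) (hX : IsSmoothNormedSpace X)
    (hsurj : Function.Surjective f) {a : X} (x : X) :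
    ∃ ε : ℝ, (ε = -1 ∨ ε = 1) ∧ ∀ (φ : StrongDual ℝ X) (g : StrongDual ℝ Y),
      (∀ y, |g (f y)| = |φ y|) → φ a ≠ 0 → g (f a) = φ a → ε * g (f x) = φ x := by
  obtain ⟨z, hz⟩ := hsurj (f a + f x)
  have key : ∀ (φ : StrongDual ℝ X) (g : StrongDual ℝ Y), g (f a) = φ a →
      g (f z) = φ a + g (f x) := fun φ g h => by rw [hz, map_add, h]
  have hz' : (z = a + x ∨ z = -(a + x)) ∨ (z = a - x ∨ z = -(a - x)) := by
    simpa only [or_assoc] using hf.eq_signed_add_of_map_eq hX hz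
  rcases hz' with hz' | hz'
  · refine ⟨1, Or.inr rfl, fun φ g hg hne ha => ?_⟩
    have hk := key φ g ha
    have hφz : |g (f z)| = |φ a + φ x| := by
      rw [hg]
      rcases hz' with rfl | rfl <;> simp only [map_neg, map_add, abs_neg]
    rw [one_mul]
    rcases abs_eq_abs.1 (hg x) with hx | hx
    · exact hx
    -- Here `φ a - φ x = ±(φ a + φ x)`: either `φ x = 0`, which suffices, or `φ a = 0`, which is
    -- excluded.
    · rcases abs_eq_abs.1 hφz with h | h
      · linarith
      · exact absurd (by linarith) hne
  · refine ⟨-1, Or.inl rfl, fun φ g hg hne ha => ?_⟩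
    have hk := key φ g ha
    have hφz : |g (f z)| = |φ a - φ x| := by
      rw [hg]
      rcases hz' with rfl | rfl <;> simp only [map_neg, map_sub, abs_neg]
    rw [neg_one_mul]
    rcases abs_eq_abs.1 (hg x) with hx | hx
    · rcases abs_eq_abs.1 hφz with h | h
      · linarith
      · exact absurd (by linarith) hne
    · linarith

/-- The functionals on `Y` compatible with `f` and normalized at a base point separate points. -/
theorem eq_zero_of_forall_apply_eq_zero (hf : IsPhaseIsometry f) (hX : IsSmoothNormedSpace X)
    (hsurj : Function.Surjective f) {a : X} (ha : a ≠ 0) {w : Y}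
    (hw : ∀ (φ : StrongDual ℝ X) (g : StrongDual ℝ Y),
      (∀ y, |g (f y)| = |φ y|) → φ a ≠ 0 → g (f a) = φ a → g w = 0) : w = 0 := by
  obtain ⟨z, rfl⟩ := hsurj w
  suffices z = 0 by rw [this, hf.map_zero]
  by_contra hz
  obtain ⟨φ, g, hg, hφ⟩ := hf.exists_abs_apply_eq_forall_apply_ne_zero hX ![a, z] (by
    intro i
    fin_cases i
    · exact ha
    · exact hz)
  have h0 : φ a ≠ 0 := hφ 0
  have h1 : φ z ≠ 0 := hφ 1
  have hgz : g (f z) = 0 := by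
    rcases abs_eq_abs.1 (hg a) with h | h
    · exact hw φ g hg h0 h
    -- The condition on `|g ∘ f|` is invariant under `g ↦ -g`, which restores the normalization at
    -- `a`.
    · have := hw φ (-g) (fun y => by rw [_root_.neg_apply, abs_neg, hg]) h0
        (by rw [_root_.neg_apply, h, neg_neg])
      rwa [_root_.neg_apply, neg_eq_zero] at this
  have := hg z
  rw [hgz, abs_zero] at this
  exact h1 (abs_eq_zero.1 this.symm)

end IsPhaseIsometry

theorem theorem2p8 {X Y : Type*} [NormedAddCommGroup X] [NormedSpace ℝ X]
    [NormedAddCommGroup Y] [NormedSpace ℝ Y] (hX : IsSmoothNormedSpace X)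
    (f : X → Y) (hf : IsPhaseIsometry f) (hsurj : Function.Surjective f) :
    IsPhaseEquivalentToLinearIsometry f := by
  rcases subsingleton_or_nontrivial X with hsub | hnt
  · refine ⟨fun _ => 1, fun _ => Or.inr rfl, ⟨0, fun x => ?_⟩, fun x => ?_⟩
    · simp [Subsingleton.elim x 0]
    · rw [Subsingleton.elim x 0, hf.map_zero, smul_zero, _root_.map_zero]
  · obtain ⟨a, ha⟩ := exists_ne (0 : X)
    choose ε hε hεg using hf.exists_sign_forall_apply_eq hX hsurj (a := a)
    refine ⟨ε, hε, ⟨⟨⟨fun x => ε x • f x, fun x y => ?_⟩, fun c x => ?_⟩, fun x => ?_⟩,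
      fun x => rfl⟩
    -- Each normalized `g` turns `ε • f` into the linear `φ`, hence kills the defect of additivity.
    · refine sub_eq_zero.1 (hf.eq_zero_of_forall_apply_eq_zero hX hsurj ha fun φ g hg h0 h => ?_)
      simp only [map_sub, map_add, map_smul, smul_eq_mul, hεg _ φ g hg h0 h, sub_self]
    · refine sub_eq_zero.1 (hf.eq_zero_of_forall_apply_eq_zero hX hsurj ha fun φ g hg h0 h => ?_)
      simp only [map_sub, map_smul, smul_eq_mul, hεg _ φ g hg h0 h, RingHom.id_apply, sub_self]
    · change ‖ε x • f x‖ = ‖x‖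
      rw [norm_smul, hf.norm_map]
      rcases hε x with h | h <;> simp [h]
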